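/- Fix a commutative semiring $K$ with $0\neq 1$. **Setting.** A vocabulary $\sigma$ is a finite set of relation symbols (each with an arity) and constant symbols. A database over $\sigma$ assigns to each constant symbol a value in $\mathbb{N}_{>0}$ and to each relation symbol of arity $a$ a $K$-relation, i.e. a function $\mathbb{N}_{>0}^a\to K$ that is nonzero on only finitely many tuples. $\mathsf{FO}^{\wedge}$ formulas over $\sigma$ are generated by $\varphi ::= R(x_1,\dots,x_k)\mid x\le c\mid \exists y.\,\varphi\mid \varphi\wedge\varphi$ and are evaluated by the usual semiring semantics: a relational atom takes the annotation of the tuple, $x\le c$ is $1$ or $0$, $\wedge$ is the product, and the value of $\exists y.\,\varphi$ at $\nu$ is the sum of the values of $\varphi$ over all valuations of the free variables of $\varphi$ that agree with $\nu$ on those other than $y$. An $\mathsf{FO}^{\wedge}$ query over $\sigma$ is an expression $H(\bar x)\leftarrow\varphi$, where $H\notin\sigma$ is a relation symbol and $\bar x$ is a tuple of variables (repetitions allowed) whose set of entries is exactly the set of free variables of $\varphi$. Its result on a database over $\sigma$ is that database extended by the $K$-relation $H$ that maps a tuple $\bar d$ to the value of $\varphi$ under $\bar x\mapsto\bar d$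 if this assignment is well defined, and to $0$ otherwise. Two queries over $\sigma$ with the same head symbol are equivalent if they have the same result on every database over $\sigma$. A query is *binary* if all relational atoms in its body and its head have arity at most two. A *conjunctive query* (CQ) is an $\mathsf{FO}^{\wedge}$ query whose body is in prenex form $\exists\bar y.\,a_1\wedge\dots\wedge a_n$ with $a_1,\dots,a_n$ atoms ($n\ge 1$). A set of atoms is *acyclic* if it has a join tree: an undirected tree with these atoms as vertices such that, for each variable $z$ occurring in some of the atoms, the atoms that contain $z$ induce a connected subtree (an atom $x\le c$ counts as unary, with variable $x$). A CQ is *free-connex* if the set $\{a_1,\dots,a_n\}$ of its body atoms is acyclic and so is $\{a_1,\dots,a_n, H(\bar x)\}$. An $\mathsf{FO}^{\wedge}_2$ *query* is a binary $\mathsf{FO}^{\wedge}$ query whose body uses at most two variables in total, free or bound. **Theorem.** Binary free-connex CQs and $\mathsf{FO}^{\wedge}_2$ queries are equally expressive. That is, for every vocabulary $\sigma$: 1. for every binary free-connex CQ $Q$ over $\sigma$ there is an $\mathsf{FO}^{\wedge}_2$ query over $\sigma$, with the same head $H(\bar x)$, that is equivalent to $Q$; 2. for every $\mathsf{FO}^{\wedge}_2$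 query $Q$ over $\sigma$ there is a binary free-connex CQ over $\sigma$, with the same head $H(\bar x)$, that is equivalent to $Q$. -/

import Mathlib

universe u v w

namespace SemiringQuery

/-- A vocabulary: finitely many relation symbols, each with an arity, and finitely many
constant symbols. -/
structure Vocabulary where
  Rel : Type u
  Const : Type v
  arity : Rel → ℕ
  [finite_rel : Finite Rel]
  [finite_const : Finite Const]

attribute [instance] Vocabulary.finite_rel Vocabulary.finite_const

/-- The vocabulary `σ ∪ {H}`, where `H = none` is a fresh relation symbol of arity `k`. -/
def Vocabulary.extend (σ : Vocabulary.{u, v}) (k : ℕ) : Vocabulary.{u, v} where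
  Rel := Option σ.Rel
  Const := σ.Const
  arity := fun R => R.elim k σ.arity

/-- The (infinite) set of variables. -/
abbrev Var : Type := ℕ

/-- A `K`-relation of arity `a` over the domain of positive natural numbers: a function from
`a`-tuples to `K` that is nonzero on only finitely many tuples. -/
abbrev KRelation (K : Type w) [Zero K] (a : ℕ) : Type w := (Fin a → ℕ+) →₀ K

/-- A database over the vocabulary `σ`, with annotations in `K`. -/
@[ext] structure Database (K : Type w) [Zero K] (σ : Vocabulary.{u, v}) where
  const : σ.Const → ℕ+
  rel : (R : σ.Rel) → KRelation K (σ.arity R)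

/-- Atoms: relational atoms `R(x₁, …, x_k)` and comparison atoms `x ≤ c`. -/
inductive Atom (σ : Vocabulary.{u, v}) : Type (max u v)
  | rel (R : σ.Rel) (x : Fin (σ.arity R) → Var) : Atom σ
  | le (x : Var) (c : σ.Const) : Atom σ

namespace Atom

variable {σ : Vocabulary.{u, v}}

/-- The set of variables of an atom; a comparison `x ≤ c` counts as a unary atom on `x`. -/
def vars : Atom σ → Finset Var
  | rel _ x => Finset.univ.image x
  | le x _ => {x}

/-- A relational atom has at most two arguments (no condition on comparison atoms). -/
def IsBinary : Atom σ → Prop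
  | rel R _ => σ.arity R ≤ 2
  | le _ _ => True

/-- An atom over `σ`, seen as an atom over `σ ∪ {H}`. -/
def lift (k : ℕ) : Atom σ → Atom (σ.extend k)
  | rel R x => Atom.rel (σ := σ.extend k) (some R) x
  | le x c => Atom.le (σ := σ.extend k) x c

/-- The value of an atom in a database under a valuation. -/
def eval {K : Type w} [CommSemiring K] (db : Database K σ) (ν : Var → ℕ+) : Atom σ → K
  | rel R x => db.rel R (fun i => ν (x i))
  | le x c => if ν x ≤ db.const c then 1 else 0

end Atom

/-- Formulas of `FO^∧`: positive first-order formulas without disjunction. -/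
inductive Formula (σ : Vocabulary.{u, v}) : Type (max u v)
  | atom (a : Atom σ) : Formula σ
  | ex (y : Var) (φ : Formula σ) : Formula σ
  | and (φ ψ : Formula σ) : Formula σ

namespace Formula

variable {σ : Vocabulary.{u, v}}

/-- The set of free variables. -/
def free : Formula σ → Finset Var
  | atom a => a.vars
  | ex y φ => φ.free.erase y
  | and φ ψ => φ.free ∪ ψ.free

/-- The set of all variables used in a formula, free or bound. -/
def vars : Formula σ → Finset Var
  | atom a => a.vars
  | ex y φ => insert y φ.vars
  | and φ ψ => φ.vars ∪ ψ.vars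

/-- The set of atoms occurring in a formula. -/
def atoms : Formula σ → Set (Atom σ)
  | atom a => {a}
  | ex _ φ => φ.atoms
  | and φ ψ => φ.atoms ∪ ψ.atoms

/-- The formula is a conjunction `a₁ ∧ … ∧ aₙ` of (at least one) atoms. -/
def IsConjunctionOfAtoms : Formula σ → Prop
  | atom _ => True
  | ex _ _ => False
  | and φ ψ => φ.IsConjunctionOfAtoms ∧ ψ.IsConjunctionOfAtoms

/-- The formula is in prenex normal form `∃ y₁ … y_m. a₁ ∧ … ∧ aₙ`. -/
def IsPrenex : Formula σ → Prop
  | atom _ => True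
  | ex _ φ => φ.IsPrenex
  | and φ ψ => (and φ ψ).IsConjunctionOfAtoms

/-- The semiring semantics of a formula. Valuations are total functions on the variables;
the value depends only on the restriction to the free variables (`eval_congr`). The value of
`∃ y. φ` at `ν` is the sum of the values of `φ` over all valuations of the free variables of `φ`
that agree with `ν` off `y`. If `y` is free in `φ`, there is one of them for every value of `y`
(and only finitely many contribute, see `exists_finset_of_eval_ne_zero`); if `y` is not free in
`φ`, there is exactly one. -/
noncomputable def eval {K : Type w} [CommSemiring K] (db : Database K σ) :
    Formula σ → (Var → ℕ+) → K
  | atom a, ν => a.eval db ν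
  | ex y φ, ν =>
      if y ∈ φ.free then ∑ᶠ d : ℕ+, φ.eval db (Function.update ν y d) else φ.eval db ν
  | and φ ψ, ν => φ.eval db ν * ψ.eval db ν

theorem eval_congr {K : Type w} [CommSemiring K] (db : Database K σ) (φ : Formula σ)
    (ν μ : Var → ℕ+) (h : ∀ x ∈ φ.free, ν x = μ x) : φ.eval db ν = φ.eval db μ := by
  induction φ generalizing ν μ with
  | atom a =>
    cases a with
    | rel R x =>
      simp only [eval, Atom.eval]
      congr 1
      funext i
      exact h _ (by simp [free, Atom.vars])
    | le x c =>
      simp only [eval, Atom.eval]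
      rw [h x (by simp [free, Atom.vars])]
  | ex y φ ih =>
    simp only [eval]
    split_ifs with hy
    · refine finsum_congr fun d => ih _ _ fun x hx => ?_
      by_cases hxy : x = y
      · subst hxy; simp
      · simp [hxy, h x (by simp [free, hxy, hx])]
    · refine ih _ _ fun x hx => h x ?_
      have hxy : x ≠ y := fun e => hy (e ▸ hx)
      simp [free, hxy, hx]
  | and φ ψ ih1 ih2 =>
    simp only [eval]
    rw [ih1 ν μ fun x hx => h x (by simp [free, hx]),
      ih2 ν μ fun x hx => h x (by simp [free, hx])]

/-- Safety: only finitely many valuations of the free variables get a nonzero value. -/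
theorem exists_finset_of_eval_ne_zero {K : Type w} [CommSemiring K] (db : Database K σ)
    (φ : Formula σ) :
    ∃ S : Finset ℕ+, ∀ ν : Var → ℕ+, φ.eval db ν ≠ 0 → ∀ x ∈ φ.free, ν x ∈ S := by
  classical
  induction φ with
  | atom a =>
    cases a with
    | rel R x =>
      refine ⟨(db.rel R).support.biUnion fun d => Finset.univ.image d, fun ν hν z hz => ?_⟩
      simp only [free, Atom.vars, Finset.mem_image, Finset.mem_univ, true_and] at hz
      obtain ⟨i, rfl⟩ := hz
      refine Finset.mem_biUnion.2 ⟨fun i => ν (x i), Finsupp.mem_support_iff.2 hν, ?_⟩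
      exact Finset.mem_image.2 ⟨i, Finset.mem_univ _, rfl⟩
    | le x c =>
      refine ⟨Finset.Icc 1 (db.const c), fun ν hν z hz => ?_⟩
      simp only [free, Atom.vars, Finset.mem_singleton] at hz
      subst hz
      simp only [eval, Atom.eval] at hν
      have hle : ν z ≤ db.const c := by
        by_contra hc
        simp [hc] at hν
      exact Finset.mem_Icc.2 ⟨one_le, hle⟩
  | ex y φ ih =>
    obtain ⟨S, hS⟩ := ih
    refine ⟨S, fun ν hν z hz => ?_⟩
    simp only [free, Finset.mem_erase] at hz
    simp only [eval] at hν
    split_ifs at hν with hy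
    · obtain ⟨d, hd⟩ : ∃ d : ℕ+, φ.eval db (Function.update ν y d) ≠ 0 := by
        by_contra! hc
        exact hν (by simp [hc])
      simpa [hz.1] using hS _ hd z hz.2
    · exact hS ν hν z hz.2
  | and φ ψ ih1 ih2 =>
    obtain ⟨S, hS⟩ := ih1
    obtain ⟨S', hS'⟩ := ih2
    refine ⟨S ∪ S', fun ν hν z hz => ?_⟩
    simp only [eval] at hν
    simp only [free, Finset.mem_union] at hz ⊢
    rcases hz with hz | hz
    · exact Or.inl (hS ν (left_ne_zero_of_mul hν) z hz)
    · exact Or.inr (hS' ν (right_ne_zero_of_mul hν) z hz)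

end Formula

/-- An `FO^∧` query `H(x₁, …, x_k) ← φ` over `σ`, with `H` a fresh relation symbol of arity `k`.
The variables of the head, which may repeat, are exactly the free variables of the body. -/
structure Query (σ : Vocabulary.{u, v}) (k : ℕ) where
  head : Fin k → Var
  body : Formula σ
  mem_free_iff : ∀ x, x ∈ body.free ↔ ∃ i, head i = x

namespace Query

variable {σ : Vocabulary.{u, v}} {k : ℕ}

open Classical in
/-- The value of the tuple `d` in the output relation: the value of the body under `x̄ ↦ d` if
`d` takes equal values wherever the head has equal variables, and `0` otherwise. The variables
outside the head are not free in the body and receive an irrelevant value. -/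
noncomputable def answer {K : Type w} [CommSemiring K] (Q : Query σ k) (db : Database K σ)
    (d : Fin k → ℕ+) : K :=
  if ∀ i j, Q.head i = Q.head j → d i = d j then
    Q.body.eval db (Function.extend Q.head d fun _ => 1)
  else 0

theorem finite_support_answer {K : Type w} [CommSemiring K] (Q : Query σ k)
    (db : Database K σ) : (Function.support (Q.answer db)).Finite := by
  obtain ⟨S, hS⟩ := Q.body.exists_finset_of_eval_ne_zero db
  refine (Set.Finite.pi' fun _ : Fin k => S.finite_toSet).subset fun d hd => ?_
  intro i
  simp only [Function.mem_support, answer] at hd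
  split_ifs at hd with h
  · have h1 := hS _ hd (Q.head i) ((Q.mem_free_iff _).2 ⟨i, rfl⟩)
    have h2 : Function.FactorsThrough d Q.head := fun a b hab => h a b hab
    rw [h2.extend_apply] at h1
    exact h1
  · exact absurd rfl hd

/-- The result of a query on a database over `σ`: the database over `σ ∪ {H}` that coincides
with the input on `σ` and maps `H` to the output relation. -/
noncomputable def eval {K : Type w} [CommSemiring K] (Q : Query σ k) (db : Database K σ) :
    Database K (σ.extend k) where
  const := db.const
  rel := fun R =>
    match R with
    | none => Finsupp.ofSupportFinite (Q.answer db) (Q.finite_support_answer db)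
    | some R => db.rel R

/-- Two queries are equivalent (over `K`) if they have the same result on every database. -/
def Equivalent (K : Type w) [CommSemiring K] (Q Q' : Query σ k) : Prop :=
  ∀ db : Database K σ, Q.eval db = Q'.eval db

/-- Every relational atom of the query, in the body or the head, has arity at most two. -/
def IsBinary (Q : Query σ k) : Prop :=
  k ≤ 2 ∧ ∀ a ∈ Q.body.atoms, a.IsBinary

/-- Conjunctive queries: the body is in prenex normal form. -/
def IsConjunctive (Q : Query σ k) : Prop := Q.body.IsPrenex

/-- Queries of the two-variable fragment of `FO^∧`: binary queries whose body uses at most two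
variables, free or bound. -/
def IsFOTwo (Q : Query σ k) : Prop :=
  Q.IsBinary ∧ Q.body.vars.card ≤ 2

end Query

/-- A set of atoms has a join tree: a tree with these atoms as vertices in which, for every
variable `z`, the atoms that contain `z` induce a connected subgraph. -/
def HasJoinTree {σ : Vocabulary.{u, v}} (A : Set (Atom σ)) : Prop :=
  ∃ T : SimpleGraph A, T.IsTree ∧
    ∀ z : Var, (T.induce {a : A | z ∈ a.1.vars}).Preconnected

namespace Query

variable {σ : Vocabulary.{u, v}} {k : ℕ}

/-- The head `H(x₁, …, x_k)`, as an atom over `σ ∪ {H}`. -/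
def headAtom (Q : Query σ k) : Atom (σ.extend k) :=
  Atom.rel (σ := σ.extend k) none Q.head

/-- Acyclicity: the atoms of the body have a join tree. -/
def IsAcyclic (Q : Query σ k) : Prop := HasJoinTree Q.body.atoms

/-- Free-connex conjunctive queries: acyclic conjunctive queries that remain acyclic when the
head is added to the body as a further atom. -/
def IsFreeConnex (Q : Query σ k) : Prop :=
  Q.IsConjunctive ∧ Q.IsAcyclic ∧
    HasJoinTree (insert Q.headAtom (Atom.lift k '' Q.body.atoms))

end Query

end SemiringQuery

/-!
In both directions variables are eliminated by distributivity: a factor that does not mention the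
variable `y` can be moved out of the sum over `y`. Since a formula
is nonzero only where its free variables take values in a finite set determined by the database
(`Database.exists_isBounding`), all sums are finite (`sumOut`) and can be permuted at will. The notion in the middle is that of a narrow formula
(`Formula.IsNarrow`): quantifiers are only applied to formulas with at most two free variables. Such
a formula can be rewritten with two variables by reusing names
(`Formula.IsNarrow.exists_vars_subset_pair`), and every formula with two variables is narrow.

*From conjunctive queries to two variables.* Root a join tree of the body and the head at the head.
It can be dismantled leaf by leaf (`exists_runningIntersection_of_isTree`), where the variables that
a leaf does not share with its parent occur nowhere else in the rest of the tree. Summing them out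
turns the leaf, which has at most two variables, into a narrow formula over variables of the parent,
to which it is attached as a further conjunct. In the end only the root is left, carrying a narrow
formula over the variables of the head (`RunningIntersection.exists_narrow`).

*From two variables to conjunctive queries.* Move all quantifiers of a narrow formula to the front,
naming the bound variables by increasing fresh numbers from the outside to the inside. Each bound
variable then occurs together with at most one smaller variable
(`Formula.IsNarrow.exists_prenex`), and so does each of the at most two free variables, whether the
head is added or not. A family of sets with this property has a join tree: a smallest set that
contains the greatest variable can be split off as a leaf (`exists_ear`).
-/

namespace SemiringQuery

/-! ### Join trees and running intersection orders -/

section JoinTree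

variable {ι α : Type*}

/-- The indices in `A` can be listed, starting with `r`, such that each further index `a` has a
parent `b` listed before it with the running intersection property: whatever `V a` shares with
the sets listed before `a` belongs to `V b`. This is a rooted join tree of the family `V` on `A`,
presented by successive additions of leaves. -/
inductive RunningIntersection [DecidableEq ι] (V : ι → Finset α) (r : ι) : Finset ι → Prop
  | root : RunningIntersection V r {r}
  | addLeaf {A : Finset ι} {a b : ι} (hA : RunningIntersection V r A) (ha : a ∉ A) (hb : b ∈ A)
      (hab : ∀ c ∈ A, ∀ z ∈ V a, z ∈ V c → z ∈ V b) : RunningIntersection V r (insert a A)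

theorem RunningIntersection.root_mem [DecidableEq ι] {V : ι → Finset α} {r : ι} {A : Finset ι}
    (h : RunningIntersection V r A) : r ∈ A := by
  induction h with
  | root => simp
  | addLeaf _ _ _ _ ih => exact Finset.mem_insert_of_mem ih

theorem preconnected_induce_insert {G : SimpleGraph ι} {s : Set ι} {a b : ι}
    (hs : (G.induce s).Preconnected) (hb : b ∈ s) (hab : G.Adj a b) :
    (G.induce (insert a s)).Preconnected := by
  have h := SimpleGraph.induce_union_connected hs
    (SimpleGraph.induce_pair_connected_of_adj hab).preconnected ⟨b, hb, by simp⟩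
  have e : s ∪ {a, b} = insert a s := by
    ext x
    simp only [Set.mem_union, Set.mem_insert_iff, Set.mem_singleton_iff]
    constructor
    · rintro (h | h | h)
      · exact Or.inr h
      · exact Or.inl h
      · exact Or.inr (h ▸ hb)
    · rintro (h | h)
      · exact Or.inr (Or.inl h)
      · exact Or.inl h
  exact e ▸ h.preconnected

theorem preconnected_induce_mono {G G' : SimpleGraph ι} {s : Set ι} (h : G ≤ G')
    (hs : (G.induce s).Preconnected) : (G'.induce s).Preconnected :=
  hs.mono fun _ _ hadj => h hadj

theorem RunningIntersection.exists_graph [DecidableEq ι] {V : ι → Finset α} {r : ι} {A : Finset ι}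
    (h : RunningIntersection V r A) :
    ∃ G : SimpleGraph ι, G.IsAcyclic ∧ (∀ u v, G.Adj u v → u ∈ A) ∧
      (G.induce (A : Set ι)).Preconnected ∧
      ∀ z, (G.induce {i | i ∈ A ∧ z ∈ V i}).Preconnected := by
  induction h with
  | root =>
    refine ⟨⊥, SimpleGraph.isAcyclic_bot, by simp, ?_, fun z => ?_⟩
    · rintro ⟨x, hx⟩ ⟨y, hy⟩
      obtain rfl : x = r := by simpa using hx
      obtain rfl : y = x := by simpa using hy
      rfl
    · rintro ⟨x, hx⟩ ⟨y, hy⟩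
      obtain rfl : x = r := by simpa using hx.1
      obtain rfl : y = x := by simpa using hy.1
      rfl
  | @addLeaf A a b hA ha hb hab ih =>
    obtain ⟨G, hG, hGA, hconn, hz⟩ := ih
    have hne : a ≠ b := fun e => ha (e ▸ hb)
    have hiso : ∀ u, ¬ G.Adj a u := fun u hu => ha (hGA _ _ hu)
    have hadj : (G ⊔ SimpleGraph.edge a b).Adj a b := by
      simp [SimpleGraph.edge_adj, hne]
    refine ⟨G ⊔ SimpleGraph.edge a b, ?_, ?_, ?_, fun z => ?_⟩
    · refine hG.sup_edge_of_not_reachable ?_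
      rintro ⟨p⟩
      cases p with
      | nil => exact hne rfl
      | cons hu _ => exact hiso _ hu
    · intro u v huv
      rw [SimpleGraph.sup_adj, SimpleGraph.edge_adj] at huv
      rcases huv with huv | ⟨⟨rfl, rfl⟩ | ⟨rfl, rfl⟩, -⟩
      · exact Finset.mem_insert_of_mem (hGA _ _ huv)
      · exact Finset.mem_insert_self _ _
      · exact Finset.mem_insert_of_mem hb
    · rw [Finset.coe_insert]
      exact preconnected_induce_insert (preconnected_induce_mono le_sup_left hconn) hb hadj
    · have hz' := preconnected_induce_mono (le_sup_left (b := SimpleGraph.edge a b)) (hz z)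
      by_cases hza : z ∈ V a
      · have e : {i | i ∈ insert a A ∧ z ∈ V i} = insert a {i | i ∈ A ∧ z ∈ V i} := by
          ext i
          simp only [Finset.mem_insert, Set.mem_ofPred_eq, Set.mem_insert_iff]
          constructor
          · rintro ⟨h | h, h'⟩
            · exact Or.inl h
            · exact Or.inr ⟨h, h'⟩
          · rintro (rfl | h)
            · exact ⟨Or.inl rfl, hza⟩
            · exact ⟨Or.inr h.1, h.2⟩
        rw [e]
        by_cases hne : ∃ c ∈ A, z ∈ V c
        · obtain ⟨c, hc, hzc⟩ := hne
          exact preconnected_induce_insert hz' ⟨hb, hab c hc z hza hzc⟩ hadj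
        · have e' : {i | i ∈ A ∧ z ∈ V i} = ∅ :=
            Set.eq_empty_of_forall_notMem fun i hi => hne ⟨i, hi⟩
          rw [e']
          rintro ⟨x, hx⟩ ⟨y, hy⟩
          obtain rfl : x = a := by simpa using hx
          obtain rfl : y = x := by simpa using hy
          rfl
      · have e : {i | i ∈ insert a A ∧ z ∈ V i} = {i | i ∈ A ∧ z ∈ V i} := by
          ext i
          simp only [Finset.mem_insert, Set.mem_ofPred_eq]
          constructor
          · rintro ⟨rfl | h, h'⟩
            · exact absurd h' hza
            · exact ⟨h, h'⟩
          · exact fun h => ⟨Or.inr h.1, h.2⟩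
        rw [e]
        exact hz'

theorem RunningIntersection.exists_isTree [DecidableEq ι] [Fintype ι] {V : ι → Finset α} {r : ι}
    (h : RunningIntersection V r Finset.univ) :
    ∃ T : SimpleGraph ι, T.IsTree ∧ ∀ z, (T.induce {i | z ∈ V i}).Preconnected := by
  obtain ⟨G, hG, -, hconn, hz⟩ := h.exists_graph
  refine ⟨G, ⟨?_, hG⟩, fun z => ?_⟩
  swap
  · have e : {i | i ∈ Finset.univ ∧ z ∈ V i} = {i | z ∈ V i} := by simp
    exact e ▸ hz z
  have : Nonempty ι := ⟨r⟩
  refine ⟨fun x y => ?_⟩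
  exact (hconn ⟨x, by simp⟩ ⟨y, by simp⟩).map (SimpleGraph.Embedding.induce _).toHom

theorem exists_isPath_of_preconnected_induce {G : SimpleGraph ι} {s : Set ι}
    (h : (G.induce s).Preconnected) {x y : ι} (hx : x ∈ s) (hy : y ∈ s) :
    ∃ p : G.Walk x y, p.IsPath ∧ ∀ z ∈ p.support, z ∈ s := by
  obtain ⟨p, hp⟩ := (h ⟨x, hx⟩ ⟨y, hy⟩).exists_isPath
  refine ⟨p.map (SimpleGraph.Embedding.induce (G := G) s).toHom,
    hp.map (SimpleGraph.Embedding.induce (G := G) s).injective, fun z hz => ?_⟩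
  replace hz : z ∈ p.support.map (SimpleGraph.Embedding.induce (G := G) s).toHom := by
    rwa [← SimpleGraph.Walk.support_map]
  obtain ⟨w, -, rfl⟩ := List.mem_map.1 hz
  exact w.2

/-- A connected vertex set of a join tree that is not everything can be enlarged by a neighbour
`a` of one of its vertices `b`; the running intersection property holds because the unique path
from `a` to any vertex of the set starts with the edge to `b`. -/
theorem exists_runningIntersection_of_isTree [DecidableEq ι] [Fintype ι] {V : ι → Finset α}
    {T : SimpleGraph ι} (hT : T.IsTree) (hV : ∀ z, (T.induce {i | z ∈ V i}).Preconnected)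
    (r : ι) :
    RunningIntersection V r Finset.univ := by
  have key : ∀ n : ℕ, n < Fintype.card ι → ∃ A : Finset ι, A.card = n + 1 ∧
      RunningIntersection V r A ∧ (T.induce (A : Set ι)).Preconnected := by
    intro n
    induction n with
    | zero =>
      intro _
      refine ⟨{r}, by simp, .root, ?_⟩
      rintro ⟨x, hx⟩ ⟨y, hy⟩
      obtain rfl : x = r := by simpa using hx
      obtain rfl : y = x := by simpa using hy
      rfl
    | succ n ih =>
      intro hn
      obtain ⟨A, hcard, hA, hconn⟩ := ih (by omega)
      obtain ⟨x, hx⟩ : ∃ x, x ∉ A := by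
        by_contra! hall
        rw [Finset.eq_univ_of_forall hall, Finset.card_univ] at hcard
        omega
      obtain ⟨p⟩ := hT.1.preconnected r x
      obtain ⟨d, -, hd1, hd2⟩ := p.exists_boundary_dart (A : Set ι) hA.root_mem hx
      obtain ⟨⟨b, a⟩, hba⟩ := d
      have hb : b ∈ A := hd1
      have ha : a ∉ A := hd2
      have hba : T.Adj b a := hba
      refine ⟨insert a A, by rw [Finset.card_insert_of_notMem ha, hcard],
        hA.addLeaf ha hb fun c hc z hza hzc => ?_, ?_⟩
      · obtain ⟨q, hq, hqA⟩ := exists_isPath_of_preconnected_induce hconn hb hc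
        obtain ⟨s, hs, hsz⟩ := exists_isPath_of_preconnected_induce (hV z) hza hzc
        have hcons : (SimpleGraph.Walk.cons hba.symm q).IsPath :=
          hq.cons fun h => ha (hqA a h)
        have heq : s = SimpleGraph.Walk.cons hba.symm q :=
          congrArg Subtype.val ((hT.2.subsingleton_path a c).elim ⟨s, hs⟩ ⟨_, hcons⟩)
        exact hsz b (by simp [heq])
      · rw [Finset.coe_insert]
        exact preconnected_induce_insert hconn hb hba.symm
  have hpos : 0 < Fintype.card ι := Fintype.card_pos_iff.2 ⟨r⟩
  obtain ⟨A, hcard, hA, -⟩ := key (Fintype.card ι - 1) (by omega)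
  rwa [(Finset.card_eq_iff_eq_univ A).1 (by omega)] at hA

/-- In the family `V` on `A`, every element has at most one smaller neighbour, where two elements
are neighbours if they occur together in a set of the family. -/
def HasUniqueLowerNeighbors [LT α] (V : ι → Finset α) (A : Set ι) : Prop :=
  ∀ z, ∀ a ∈ A, ∀ b ∈ A, z ∈ V a → z ∈ V b → ∀ x ∈ V a, ∀ y ∈ V b, x < z → y < z → x = y

/-- An ear is found at the greatest element `z` of the union: every set that contains `z` is `{z}`
or `{z, w}` for one and the same `w`, and a smallest one among them can be split off. -/
theorem exists_ear [LinearOrder α] {V : ι → Finset α} {A : Finset ι}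
    (h : HasUniqueLowerNeighbors V (A : Set ι)) (hA : A.Nontrivial) :
    ∃ a ∈ A, ∃ b ∈ A, a ≠ b ∧ ∀ c ∈ A, c ≠ a → ∀ z ∈ V a, z ∈ V c → z ∈ V b := by
  by_cases hne : (A.biUnion V).Nonempty
  · set z := (A.biUnion V).max' hne with hz
    have hle : ∀ a ∈ A, ∀ x ∈ V a, x ≠ z → x < z := fun a ha x hx hxz =>
      lt_of_le_of_ne (Finset.le_max' _ _ (Finset.mem_biUnion.2 ⟨a, ha, hx⟩)) hxz
    obtain ⟨a₀, ha₀, hza₀⟩ := Finset.mem_biUnion.1 (Finset.max'_mem _ hne)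
    obtain ⟨a, ha, hmin⟩ := Finset.exists_min_image (A.filter fun a => z ∈ V a)
      (fun a => (V a).card) ⟨a₀, Finset.mem_filter.2 ⟨ha₀, hza₀⟩⟩
    obtain ⟨haA, hza⟩ := Finset.mem_filter.1 ha
    by_cases hb : ∃ b ∈ A, b ≠ a ∧ z ∈ V b
    · obtain ⟨b, hbA, hba, hzb⟩ := hb
      refine ⟨a, haA, b, hbA, hba.symm, fun c _ _ x hx _ => ?_⟩
      by_cases hxz : x = z
      · exact hxz ▸ hzb
      · by_contra hxb
        -- `V b` has no element below `z` but `x`, so that it is `{z}` and smaller than `V a`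
        have hbz : V b ⊆ {z} := fun y hy => by
          by_contra hyz
          have hyz : y ≠ z := by simpa using hyz
          have := h z a haA b hbA hza hzb x hx y hy (hle a haA x hx hxz) (hle b hbA y hy hyz)
          exact hxb (this ▸ hy)
        have h1 : (V b).card ≤ 1 := by simpa using Finset.card_le_card hbz
        have h2 := hmin b (Finset.mem_filter.2 ⟨hbA, hzb⟩)
        exact hxz (Finset.card_le_one.1 (h2.trans h1) x hx z hza)
    · push Not at hb
      by_cases hw : ∃ b ∈ A, b ≠ a ∧ ∃ w ∈ V a, w ∈ V b
      · obtain ⟨b, hbA, hba, w, hwa, hwb⟩ := hw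
        refine ⟨a, haA, b, hbA, hba.symm, fun c hcA hca x hx hxc => ?_⟩
        have hxz : x ≠ z := fun e => hb c hcA hca (e ▸ hxc)
        have hwz : w ≠ z := fun e => hb b hbA hba (e ▸ hwb)
        have := h z a haA a haA hza hza x hx w hwa (hle a haA x hx hxz) (hle a haA w hwa hwz)
        exact this ▸ hwb
      · push Not at hw
        obtain ⟨b, hbA, hba⟩ := hA.exists_ne a
        exact ⟨a, haA, b, hbA, hba.symm,
          fun c hcA hca x hx hxc => absurd hxc (hw c hcA hca x hx)⟩
  · obtain ⟨a, ha, b, hb, hab⟩ := hA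
    exact ⟨a, ha, b, hb, hab, fun c _ _ x hx _ =>
      absurd ⟨x, Finset.mem_biUnion.2 ⟨a, ha, hx⟩⟩ hne⟩

theorem HasUniqueLowerNeighbors.exists_runningIntersection [DecidableEq ι] [LinearOrder α]
    {V : ι → Finset α}
    {A : Finset ι} (h : HasUniqueLowerNeighbors V (A : Set ι)) (hA : A.Nonempty) :
    ∃ r, RunningIntersection V r A := by
  induction A using Finset.strongInduction with
  | H A ih =>
    rcases hA.exists_eq_singleton_or_nontrivial with ⟨r, rfl⟩ | hnt
    · exact ⟨r, .root⟩
    · obtain ⟨a, ha, b, hb, hab, hear⟩ := exists_ear h hnt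
      have hsub : ∀ c ∈ A.erase a, c ∈ A := fun c hc => Finset.mem_of_mem_erase hc
      obtain ⟨r, hr⟩ := ih (A.erase a) (Finset.erase_ssubset ha)
        (fun z c hc d hd => h z c (hsub c hc) d (hsub d hd))
        ⟨b, Finset.mem_erase.2 ⟨hab.symm, hb⟩⟩
      refine ⟨r, Finset.insert_erase ha ▸ hr.addLeaf (Finset.notMem_erase a A)
        (Finset.mem_erase.2 ⟨hab.symm, hb⟩) fun c hc z hza hzc => ?_⟩
      exact hear c (hsub c hc) (Finset.ne_of_mem_erase hc) z hza hzc

end JoinTree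

section Atoms

variable {σ : Vocabulary.{u, v}}

theorem HasJoinTree.runningIntersection {A : Set (Atom σ)} [Fintype A] [DecidableEq A]
    (h : HasJoinTree A) (r : A) :
    RunningIntersection (fun a : A => a.1.vars) r Finset.univ := by
  obtain ⟨T, hT, hV⟩ := h
  exact exists_runningIntersection_of_isTree hT hV r

theorem hasJoinTree_of_hasUniqueLowerNeighbors {A : Set (Atom σ)} (hfin : A.Finite)
    (hne : A.Nonempty) (h : HasUniqueLowerNeighbors Atom.vars A) : HasJoinTree A := by
  classical
  have := hfin.fintype
  have h' : HasUniqueLowerNeighbors (fun a : A => a.1.vars) ((Finset.univ : Finset A) : Set A) :=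
    fun z a _ b _ => h z a.1 a.2 b.1 b.2
  obtain ⟨r, hr⟩ := h'.exists_runningIntersection ⟨⟨_, hne.some_mem⟩, Finset.mem_univ _⟩
  exact hr.exists_isTree

end Atoms

/-! ### Existential quantification as a finite sum -/

section Semantics

variable {σ : Vocabulary.{u, v}} {K : Type w}

/-- `S` contains every value that can occur in a valuation under which an atom is nonzero. -/
def Database.IsBounding [Zero K] (db : Database K σ) (S : Finset ℕ+) : Prop :=
  (∀ R d, db.rel R d ≠ 0 → ∀ i, d i ∈ S) ∧ ∀ c, ∀ n ≤ db.const c, n ∈ S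

theorem Database.exists_isBounding [Zero K] (db : Database K σ) : ∃ S, db.IsBounding S := by
  classical
  have := Fintype.ofFinite σ.Rel
  have := Fintype.ofFinite σ.Const
  refine ⟨(Finset.univ.biUnion fun R => (db.rel R).support.biUnion fun d =>
    Finset.univ.image d) ∪ Finset.univ.biUnion fun c => Finset.Icc 1 (db.const c),
    fun R d hd i => ?_, fun c n hn => ?_⟩
  · refine Finset.mem_union_left _ (Finset.mem_biUnion.2 ⟨R, Finset.mem_univ _, ?_⟩)
    refine Finset.mem_biUnion.2 ⟨d, Finsupp.mem_support_iff.2 hd, ?_⟩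
    exact Finset.mem_image_of_mem _ (Finset.mem_univ i)
  · refine Finset.mem_union_right _ (Finset.mem_biUnion.2 ⟨c, Finset.mem_univ _, ?_⟩)
    exact Finset.mem_Icc.2 ⟨one_le, hn⟩

variable [CommSemiring K]

theorem Formula.mem_of_eval_ne_zero {db : Database K σ} {S : Finset ℕ+} (hS : db.IsBounding S)
    (φ : Formula σ) (ν : Var → ℕ+) (h : φ.eval db ν ≠ 0) : ∀ x ∈ φ.free, ν x ∈ S := by
  induction φ generalizing ν with
  | atom a =>
    cases a with
    | rel R y =>
      intro x hx
      simp only [free, Atom.vars, Finset.mem_image, Finset.mem_univ, true_and] at hx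
      obtain ⟨i, rfl⟩ := hx
      exact hS.1 R _ h i
    | le y c =>
      intro x hx
      simp only [free, Atom.vars, Finset.mem_singleton] at hx
      subst hx
      by_cases hle : ν x ≤ db.const c
      · exact hS.2 c _ hle
      · simp [eval, Atom.eval, hle] at h
  | ex y φ ih =>
    intro x hx
    simp only [free, Finset.mem_erase] at hx
    simp only [eval] at h
    split_ifs at h with hy
    · obtain ⟨d, hd⟩ : ∃ d : ℕ+, φ.eval db (Function.update ν y d) ≠ 0 := by
        by_contra! hc
        exact h (by simp [hc])
      simpa [hx.1] using ih _ hd x hx.2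
    · exact ih ν h x hx.2
  | and φ ψ ih1 ih2 =>
    intro x hx
    simp only [free, Finset.mem_union] at hx
    simp only [eval] at h
    exact hx.elim (ih1 ν (left_ne_zero_of_mul h) x) (ih2 ν (right_ne_zero_of_mul h) x)

theorem Formula.eval_ex_of_mem {db : Database K σ} {S : Finset ℕ+} (hS : db.IsBounding S)
    {φ : Formula σ} {y : Var} (hy : y ∈ φ.free) (ν : Var → ℕ+) :
    (ex y φ).eval db ν = ∑ d ∈ S, φ.eval db (Function.update ν y d) := by
  rw [eval, if_pos hy]
  refine finsum_eq_sum_of_support_subset _ fun d hd => ?_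
  simpa using φ.mem_of_eval_ne_zero hS _ hd y hy

theorem Formula.eval_ex_of_notMem (db : Database K σ) {φ : Formula σ} {y : Var}
    (hy : y ∉ φ.free) (ν : Var → ℕ+) : (ex y φ).eval db ν = φ.eval db ν := by
  rw [eval, if_neg hy]

/-- The sum of `F` over all values in `S` of the variables in the list. -/
def sumOut (S : Finset ℕ+) : List Var → ((Var → ℕ+) → K) → (Var → ℕ+) → K
  | [], F, ν => F ν
  | y :: L, F, ν => ∑ d ∈ S, sumOut S L F (Function.update ν y d)

variable {S : Finset ℕ+}

theorem sumOut_append (L L' : List Var) (F : (Var → ℕ+) → K) (ν : Var → ℕ+) :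
    sumOut S (L ++ L') F ν = sumOut S L (sumOut S L' F) ν := by
  induction L generalizing ν with
  | nil => rfl
  | cons y L ih => exact Finset.sum_congr rfl fun d _ => ih _

theorem sumOut_perm {L L' : List Var} (h : L.Perm L') (F : (Var → ℕ+) → K) (ν : Var → ℕ+) :
    sumOut S L F ν = sumOut S L' F ν := by
  induction h generalizing ν with
  | nil => rfl
  | cons y _ ih => exact Finset.sum_congr rfl fun d _ => ih _
  | swap x y L =>
    by_cases hxy : x = y
    · rw [hxy]
    · simp only [sumOut]
      rw [Finset.sum_comm]
      simp only [Function.update_comm hxy]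
  | trans _ _ ih1 ih2 => rw [ih1, ih2]

theorem sumOut_congr {L : List Var} {F F' : (Var → ℕ+) → K} (h : ∀ ν, F ν = F' ν)
    (ν : Var → ℕ+) : sumOut S L F ν = sumOut S L F' ν := by
  rw [funext h]

theorem sumOut_mul_left {L : List Var} {F G : (Var → ℕ+) → K}
    (hG : ∀ y ∈ L, ∀ ν d, G (Function.update ν y d) = G ν) (ν : Var → ℕ+) :
    sumOut S L (fun μ => G μ * F μ) ν = G ν * sumOut S L F ν := by
  induction L generalizing ν with
  | nil => rfl
  | cons y L ih =>
    simp only [sumOut, Finset.mul_sum]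
    refine Finset.sum_congr rfl fun d _ => ?_
    rw [ih fun z hz => hG z (List.mem_cons_of_mem y hz), hG y List.mem_cons_self]

theorem Formula.eval_update_of_notMem (db : Database K σ) {φ : Formula σ} {y : Var}
    (hy : y ∉ φ.free) (ν : Var → ℕ+) (d : ℕ+) :
    φ.eval db (Function.update ν y d) = φ.eval db ν :=
  φ.eval_congr db _ _ fun x hx =>
    Function.update_of_ne (fun e => hy (by rwa [← e])) _ _

end Semantics

/-! ### Blocks of quantifiers and conjunctions -/

namespace Formula

variable {σ : Vocabulary.{u, v}} {K : Type w} [CommSemiring K]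

/-- The formula `∃ y₁ … y_m. φ`. -/
def exList (L : List Var) (φ : Formula σ) : Formula σ := L.foldr ex φ

@[simp] theorem exList_nil (φ : Formula σ) : exList [] φ = φ := rfl

@[simp] theorem exList_cons (y : Var) (L : List Var) (φ : Formula σ) :
    exList (y :: L) φ = ex y (exList L φ) := rfl

theorem mem_free_exList {L : List Var} {φ : Formula σ} {x : Var} :
    x ∈ (exList L φ).free ↔ x ∈ φ.free ∧ x ∉ L := by
  induction L with
  | nil => simp
  | cons y L ih => simp only [exList_cons, free, Finset.mem_erase, ih, List.mem_cons]; tauto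

theorem atoms_exList (L : List Var) (φ : Formula σ) : (exList L φ).atoms = φ.atoms := by
  induction L with
  | nil => rfl
  | cons y L ih => simp [atoms, ih]

theorem isPrenex_exList (L : List Var) {φ : Formula σ} (h : φ.IsConjunctionOfAtoms) :
    (exList L φ).IsPrenex := by
  induction L with
  | nil =>
    cases φ with
    | atom a => trivial
    | ex y φ => exact h.elim
    | and φ ψ => exact h
  | cons y L ih => exact ih

theorem eval_exList {db : Database K σ} {S : Finset ℕ+} (hS : db.IsBounding S) {L : List Var}
    {φ : Formula σ} (hL : L.Nodup) (hsub : ∀ y ∈ L, y ∈ φ.free) (ν : Var → ℕ+) :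
    (exList L φ).eval db ν = sumOut S L (φ.eval db) ν := by
  induction L generalizing ν with
  | nil => rfl
  | cons y L ih =>
    have hy := List.nodup_cons.1 hL
    rw [exList_cons, eval_ex_of_mem hS
      (mem_free_exList.2 ⟨hsub y List.mem_cons_self, hy.1⟩)]
    exact Finset.sum_congr rfl fun d _ =>
      ih hy.2 (fun z hz => hsub z (List.mem_cons_of_mem y hz)) _

theorem finite_atoms (φ : Formula σ) : φ.atoms.Finite := by
  induction φ with
  | atom a => exact Set.finite_singleton a
  | ex y φ ih => exact ih
  | and φ ψ ih1 ih2 => exact ih1.union ih2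

theorem atoms_nonempty (φ : Formula σ) : φ.atoms.Nonempty := by
  induction φ with
  | atom a => exact Set.singleton_nonempty a
  | ex y φ ih => exact ih
  | and φ ψ ih1 ih2 => exact ih1.inl

theorem IsConjunctionOfAtoms.mem_free_iff {φ : Formula σ} (h : φ.IsConjunctionOfAtoms) (x : Var) :
    x ∈ φ.free ↔ ∃ a ∈ φ.atoms, x ∈ a.vars := by
  induction φ with
  | atom a => simp [free, atoms]
  | ex y φ => exact h.elim
  | and φ ψ ih1 ih2 =>
    simp only [free, Finset.mem_union, ih1 h.1, ih2 h.2, atoms, Set.mem_union, or_and_right,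
      exists_or]

/-- The conjuncts of a conjunction of atoms, with multiplicities. -/
theorem IsConjunctionOfAtoms.exists_list {φ : Formula σ} (h : φ.IsConjunctionOfAtoms) :
    ∃ l : List (Atom σ), (∀ a, a ∈ l ↔ a ∈ φ.atoms) ∧
      ∀ (db : Database K σ) (ν : Var → ℕ+), φ.eval db ν = (l.map (Atom.eval db ν)).prod := by
  induction φ with
  | atom a => exact ⟨[a], by simp [atoms], by simp [eval]⟩
  | ex y φ => exact h.elim
  | and φ ψ ih1 ih2 =>
    obtain ⟨l1, h1, e1⟩ := ih1 h.1
    obtain ⟨l2, h2, e2⟩ := ih2 h.2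
    exact ⟨l1 ++ l2, by simp [atoms, h1, h2], by simp [eval, e1, e2]⟩

/-- A prenex formula is a block of quantifiers, each binding a variable of the matrix, in front of
a conjunction of atoms. Vacuous quantifiers and shadowed ones can be dropped. -/
theorem IsPrenex.exists_exList {φ : Formula σ} (h : φ.IsPrenex) :
    ∃ (M : Formula σ) (L : List Var), M.IsConjunctionOfAtoms ∧ L.Nodup ∧ M.atoms = φ.atoms ∧
      (∀ x, x ∈ L ↔ x ∈ M.free ∧ x ∉ φ.free) ∧ (∀ x ∈ φ.free, x ∈ M.free) ∧
      ∀ (db : Database K σ) (S : Finset ℕ+), db.IsBounding S → ∀ ν,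
        φ.eval db ν = sumOut S L (M.eval db) ν := by
  induction φ with
  | atom a => exact ⟨atom a, [], trivial, .nil, rfl, by simp, by simp, fun _ _ _ _ => rfl⟩
  | and φ ψ => exact ⟨and φ ψ, [], h, .nil, rfl, by simp, by simp, fun _ _ _ _ => rfl⟩
  | ex y φ ih =>
    obtain ⟨M, L, hM, hL, hatoms, hmem, hfree, heval⟩ := ih h
    by_cases hy : y ∈ φ.free
    · refine ⟨M, y :: L, hM, List.nodup_cons.2 ⟨fun hyL => ((hmem y).1 hyL).2 hy, hL⟩, hatoms,
        fun x => ?_, fun x hx => hfree x (Finset.mem_of_mem_erase hx), fun db S hS ν => ?_⟩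
      · simp only [List.mem_cons, hmem, free, Finset.mem_erase]
        by_cases hxy : x = y
        · subst hxy
          simp [hfree x hy]
        · simp [hxy]
      · rw [eval_ex_of_mem hS hy]
        exact Finset.sum_congr rfl fun d _ => heval db S hS _
    · have e : φ.free.erase y = φ.free := Finset.erase_eq_of_notMem hy
      refine ⟨M, L, hM, hL, hatoms, ?_, ?_, fun db S hS ν => ?_⟩
      · simpa only [free, e] using hmem
      · simpa only [free, e] using hfree
      · rw [eval_ex_of_notMem db hy, heval db S hS]

end Formula

theorem Query.equivalent_of_eval_body_eq {σ : Vocabulary.{u, v}} {K : Type w} [CommSemiring K]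
    {k : ℕ} {Q Q' : Query σ k} (hhead : Q'.head = Q.head)
    (h : ∀ (db : Database K σ) ν, Q.body.eval db ν = Q'.body.eval db ν) : Q.Equivalent K Q' := by
  intro db
  have hans : Q.answer db = Q'.answer db := by
    funext d
    simp only [Query.answer, hhead, h]
  refine Database.ext rfl (funext fun R => ?_)
  cases R with
  | none =>
    refine Finsupp.ext fun d => ?_
    exact congrFun hans d
  | some R => rfl

/-! ### Narrow formulas and two variables -/

namespace Formula

variable {σ : Vocabulary.{u, v}} {K : Type w} [CommSemiring K]

/-- A formula is narrow if its relational atoms are at most binary and quantifiers are only applied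
to formulas with at most two free variables. The number of variables used is not restricted; it can
be brought down to two by renaming bound variables (`exists_vars_subset_pair`). -/
def IsNarrow : Formula σ → Prop
  | atom a => a.IsBinary
  | ex _ φ => φ.free.card ≤ 2 ∧ φ.IsNarrow
  | and φ ψ => φ.IsNarrow ∧ ψ.IsNarrow

theorem IsNarrow.exList {L : List Var} {φ : Formula σ} (h : φ.IsNarrow) (hcard : φ.free.card ≤ 2) :
    (exList L φ).IsNarrow := by
  induction L with
  | nil => exact h
  | cons y L ih =>
    exact ⟨(Finset.card_le_card fun x hx => (mem_free_exList.1 hx).1).trans hcard, ih⟩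

theorem free_subset_vars (φ : Formula σ) : φ.free ⊆ φ.vars := by
  induction φ with
  | atom a => exact subset_rfl
  | ex y φ ih =>
    exact (Finset.erase_subset _ _).trans (ih.trans (Finset.subset_insert _ _))
  | and φ ψ ih1 ih2 => exact Finset.union_subset_union ih1 ih2

theorem isNarrow_of_card_vars_le {φ : Formula σ} (hcard : φ.vars.card ≤ 2)
    (hbin : ∀ a ∈ φ.atoms, a.IsBinary) : φ.IsNarrow := by
  induction φ with
  | atom a => exact hbin a rfl
  | ex y φ ih =>
    have h : φ.vars.card ≤ 2 := (Finset.card_le_card (Finset.subset_insert _ _)).trans hcard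
    exact ⟨(Finset.card_le_card φ.free_subset_vars).trans h, ih h hbin⟩
  | and φ ψ ih1 ih2 =>
    exact ⟨ih1 ((Finset.card_le_card Finset.subset_union_left).trans hcard)
        fun a ha => hbin a (Or.inl ha),
      ih2 ((Finset.card_le_card Finset.subset_union_right).trans hcard)
        fun a ha => hbin a (Or.inr ha)⟩

end Formula

namespace Atom

variable {σ : Vocabulary.{u, v}} {K : Type w} [CommSemiring K]

/-- Renaming of the variables of an atom. -/
def rename (ρ : Var → Var) : Atom σ → Atom σ
  | rel R x => rel R (ρ ∘ x)
  | le x c => le (ρ x) c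

theorem vars_rename (ρ : Var → Var) (a : Atom σ) : (a.rename ρ).vars = a.vars.image ρ := by
  cases a with
  | rel R x => simp [rename, vars, Finset.image_image]
  | le x c => simp [rename, vars]

theorem IsBinary.rename {a : Atom σ} (h : a.IsBinary) (ρ : Var → Var) :
    (a.rename ρ).IsBinary := by
  cases a <;> exact h

theorem eval_rename (db : Database K σ) (ρ : Var → Var) (ν : Var → ℕ+) (a : Atom σ) :
    (a.rename ρ).eval db ν = a.eval db (ν ∘ ρ) := by
  cases a <;> rfl

end Atom

theorem injOn_update_of_notMem_image {s : Finset Var} {ρ : Var → Var} {y w : Var}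
    (hρ : Set.InjOn ρ (s.erase y)) (hw : w ∉ (s.erase y).image ρ) :
    Set.InjOn (Function.update ρ y w) s := by
  intro x hx z hz hxz
  have hne : ∀ z ∈ s, z ≠ y → ρ z ≠ w := fun z hz hzy e =>
    hw (Finset.mem_image.2 ⟨z, Finset.mem_erase.2 ⟨hzy, hz⟩, e⟩)
  by_cases hxy : x = y <;> by_cases hzy : z = y
  · rw [hxy, hzy]
  · subst hxy
    rw [Function.update_self, Function.update_of_ne hzy] at hxz
    exact absurd hxz.symm (hne z hz hzy)
  · subst hzy
    rw [Function.update_self, Function.update_of_ne hxy] at hxz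
    exact absurd hxz (hne x hx hxy)
  · rw [Function.update_of_ne hxy, Function.update_of_ne hzy] at hxz
    exact hρ (by simpa using ⟨hx, hxy⟩) (by simpa using ⟨hz, hzy⟩) hxz

theorem image_update_erase {s : Finset Var} {ρ : Var → Var} {y w : Var}
    (hw : w ∉ (s.erase y).image ρ) :
    (s.image (Function.update ρ y w)).erase w = (s.erase y).image ρ := by
  ext x
  simp only [Finset.mem_erase, Finset.mem_image]
  constructor
  · rintro ⟨hx, z, hz, rfl⟩
    have hzy : z ≠ y := fun e => hx (by rw [e, Function.update_self])
    exact ⟨z, ⟨hzy, hz⟩, (Function.update_of_ne hzy _ _).symm⟩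
  · rintro ⟨z, ⟨hzy, hz⟩, rfl⟩
    refine ⟨fun e => hw ?_, z, hz, Function.update_of_ne hzy _ _⟩
    exact Finset.mem_image.2 ⟨z, Finset.mem_erase.2 ⟨hzy, hz⟩, e⟩

namespace Formula

variable {σ : Vocabulary.{u, v}} {K : Type w} [CommSemiring K]

/-- Updating a renamed valuation is renaming an updated one, if the new name `w` of `y` is not the
name of another free variable. -/
theorem eval_update_comp_update (db : Database K σ) {φ : Formula σ} {ρ : Var → Var} {y w : Var}
    (hw : w ∉ (φ.free.erase y).image ρ) (ν : Var → ℕ+) (d : ℕ+) :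
    φ.eval db (Function.update ν w d ∘ Function.update ρ y w) =
      φ.eval db (Function.update (ν ∘ ρ) y d) := by
  refine φ.eval_congr db _ _ fun x hx => ?_
  by_cases hxy : x = y
  · subst hxy
    simp
  · have hxw : ρ x ≠ w := fun e =>
      hw (Finset.mem_image.2 ⟨x, Finset.mem_erase.2 ⟨hxy, hx⟩, e⟩)
    simp [hxy, hxw]

/-- The free variables of a narrow formula can be renamed, injectively, to two given variables, and
the bound ones with them: when a variable gets bound, at most one other variable is free, so that
one of the two given variables is available for it. -/
theorem IsNarrow.exists_vars_subset_pair {p q : Var} (hpq : p ≠ q) {φ : Formula σ}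
    (h : φ.IsNarrow) (ρ : Var → Var) (hρ : Set.InjOn ρ φ.free)
    (hmaps : ∀ x ∈ φ.free, ρ x ∈ ({p, q} : Finset Var)) :
    ∃ ψ : Formula σ, ψ.vars ⊆ {p, q} ∧ ψ.free = φ.free.image ρ ∧ (∀ a ∈ ψ.atoms, a.IsBinary) ∧
      ∀ (db : Database K σ) ν, ψ.eval db ν = φ.eval db (ν ∘ ρ) := by
  induction φ generalizing ρ with
  | atom a =>
    refine ⟨atom (a.rename ρ), ?_, a.vars_rename ρ, ?_, fun db ν => a.eval_rename db ρ ν⟩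
    · intro x hx
      rw [vars, a.vars_rename, Finset.mem_image] at hx
      obtain ⟨z, hz, rfl⟩ := hx
      exact hmaps z hz
    · rintro _ rfl
      exact Atom.IsBinary.rename h ρ
  | ex y φ ih =>
    by_cases hy : y ∈ φ.free
    · obtain ⟨w, hwpq, hw⟩ : ∃ w ∈ ({p, q} : Finset Var), w ∉ (φ.free.erase y).image ρ := by
        have hlt : ((φ.free.erase y).image ρ).card < ({p, q} : Finset Var).card := by
          have h1 := Finset.card_image_le (s := φ.free.erase y) (f := ρ)
          have h2 := Finset.card_erase_add_one hy
          have h3 := h.1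
          rw [Finset.card_pair hpq]
          omega
        exact Finset.exists_mem_notMem_of_card_lt_card hlt
      obtain ⟨ψ, hvars, hfree, hbin, heval⟩ := ih h.2 (Function.update ρ y w)
        (injOn_update_of_notMem_image hρ hw) fun x hx => by
          by_cases hxy : x = y
          · rwa [hxy, Function.update_self]
          · rw [Function.update_of_ne hxy]
            exact hmaps x (Finset.mem_erase.2 ⟨hxy, hx⟩)
      have hwψ : w ∈ ψ.free := by
        rw [hfree]
        exact Finset.mem_image.2 ⟨y, hy, Function.update_self _ _ _⟩
      refine ⟨ex w ψ, Finset.insert_subset hwpq hvars, ?_, hbin, fun db ν => ?_⟩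
      · rw [free, hfree, image_update_erase hw, free]
      · rw [eval, if_pos hwψ, eval, if_pos hy]
        exact finsum_congr fun d => by rw [heval, eval_update_comp_update db hw]
    · have e : φ.free.erase y = φ.free := Finset.erase_eq_of_notMem hy
      simp only [free, e] at hρ hmaps ⊢
      obtain ⟨ψ, hvars, hfree, hbin, heval⟩ := ih h.2 ρ hρ hmaps
      exact ⟨ψ, hvars, hfree, hbin, fun db ν => by rw [heval, eval_ex_of_notMem db hy]⟩
  | and φ φ' ih1 ih2 =>
    simp only [free, Finset.coe_union, Finset.mem_union] at hρ hmaps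
    obtain ⟨ψ1, hv1, hf1, hb1, he1⟩ := ih1 h.1 ρ (hρ.mono Set.subset_union_left)
      fun x hx => hmaps x (Or.inl hx)
    obtain ⟨ψ2, hv2, hf2, hb2, he2⟩ := ih2 h.2 ρ (hρ.mono Set.subset_union_right)
      fun x hx => hmaps x (Or.inr hx)
    refine ⟨and ψ1 ψ2, Finset.union_subset hv1 hv2, ?_, fun a ha => ha.elim (hb1 a) (hb2 a),
      fun db ν => by simp only [eval, he1, he2]⟩
    simp only [free, hf1, hf2, Finset.image_union]

theorem exists_conj {l : List (Formula σ)} (hl : l ≠ []) (hnarrow : ∀ φ ∈ l, φ.IsNarrow) :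
    ∃ ψ : Formula σ, ψ.IsNarrow ∧ (∀ x, x ∈ ψ.free ↔ ∃ φ ∈ l, x ∈ φ.free) ∧
      ∀ (db : Database K σ) ν, ψ.eval db ν = (l.map fun φ => φ.eval db ν).prod := by
  induction l with
  | nil => exact absurd rfl hl
  | cons φ l ih =>
    by_cases hl' : l = []
    · subst hl'
      exact ⟨φ, hnarrow φ (by simp), by simp, by simp⟩
    · obtain ⟨ψ, hψ, hfree, heval⟩ := ih hl' fun χ hχ => hnarrow χ (List.mem_cons_of_mem φ hχ)
      refine ⟨and φ ψ, ⟨hnarrow φ (by simp), hψ⟩, ?_, ?_⟩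
      · simp [free, hfree]
      · simp [eval, heval]

end Formula

/-! ### Summing out the variables along a join tree -/

section Elimination

variable {σ : Vocabulary.{u, v}} {K : Type w} [CommSemiring K]
variable {ι : Type*} [DecidableEq ι] {V : ι → Finset Var} {r : ι} {A : Finset ι}

/-- Given a rooted join tree whose nodes `i` carry lists `c i` of narrow formulas over `V i`, the
sum over all variables outside the root of the product of all these formulas is a product of narrow
formulas over the root. The last leaf `a` is merged into its parent `b`: as the variables in
`V a \ V b` occur in no other node, the sum over them is `∃ (V a \ V b). ⋀ c a`, which is added to
`c b`. -/
theorem RunningIntersection.exists_narrow (h : RunningIntersection V r A)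
    (c : ι → List (Formula σ))
    (hcard : ∀ i ∈ A, i ≠ r → (V i).card ≤ 2)
    (hc : ∀ i ∈ A, ∀ φ ∈ c i, φ.IsNarrow ∧ φ.free ⊆ V i)
    (hne : ∀ i ∈ A, i ≠ r → c i ≠ [])
    (hV : ∀ i ∈ A, i ≠ r → ∀ x ∈ V i, ∃ φ ∈ c i, x ∈ φ.free) :
    ∃ l : List (Formula σ), (∀ φ ∈ l, φ.IsNarrow ∧ φ.free ⊆ V r) ∧
      (∀ x ∈ V r, (∃ i ∈ A, ∃ φ ∈ c i, x ∈ φ.free) → ∃ φ ∈ l, x ∈ φ.free) ∧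
      ((∃ i ∈ A, c i ≠ []) → l ≠ []) ∧
      ∀ L : List Var, L.Nodup → (∀ x, x ∈ L ↔ x ∉ V r ∧ ∃ i ∈ A, x ∈ V i) →
        ∀ (db : Database K σ) (S : Finset ℕ+), db.IsBounding S → ∀ ν,
          (l.map fun φ => φ.eval db ν).prod =
            sumOut S L (fun μ => ∏ i ∈ A, ((c i).map fun φ => φ.eval db μ).prod) ν := by
  induction h generalizing c with
  | root =>
    refine ⟨c r, hc r (by simp), ?_, ?_, ?_⟩
    · rintro x - ⟨i, hi, hx⟩
      rwa [Finset.mem_singleton.1 hi] at hx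
    · rintro ⟨i, hi, hx⟩
      rwa [Finset.mem_singleton.1 hi] at hx
    · intro L _ hL db S _ ν
      have : L = [] := List.eq_nil_iff_forall_not_mem.2 fun x hx => by
        have := (hL x).1 hx
        simp at this
      simp [this, sumOut]
  | @addLeaf A a b hA ha hb hab ih =>
    have hr := hA.root_mem
    have har : a ≠ r := fun e => ha (e ▸ hr)
    have haA : a ∈ insert a A := Finset.mem_insert_self a A
    have hins : ∀ i ∈ A, i ∈ insert a A := fun i hi => Finset.mem_insert_of_mem hi
    obtain ⟨ψ, hψ, hψfree, hψeval⟩ := Formula.exists_conj (K := K) (hne a haA har)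
      fun φ hφ => (hc a haA φ hφ).1
    have hψV : ψ.free = V a := by
      ext x
      rw [hψfree]
      exact ⟨fun ⟨φ, hφ, hx⟩ => (hc a haA φ hφ).2 hx, hV a haA har x⟩
    let P : List Var := (V a \ V b).toList
    have hP : ∀ x, x ∈ P ↔ x ∈ V a ∧ x ∉ V b := by simp [P]
    let χ := Formula.exList P ψ
    have hχfree : ∀ x, x ∈ χ.free ↔ x ∈ V a ∧ x ∈ V b := fun x => by
      rw [Formula.mem_free_exList, hP, hψV]
      tauto
    have hχ : χ.IsNarrow := hψ.exList (hψV ▸ hcard a haA har)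
    let c' : ι → List (Formula σ) := Function.update c b (χ :: c b)
    have hb' : c' b = χ :: c b := Function.update_self _ _ _
    have hne' : ∀ i, i ≠ b → c' i = c i := fun i hi => Function.update_of_ne hi _ _
    have hmono : ∀ i, ∀ φ ∈ c i, φ ∈ c' i := fun i φ hφ => by
      by_cases hib : i = b
      · subst hib
        rw [hb']
        exact List.mem_cons_of_mem _ hφ
      · rwa [hne' i hib]
    obtain ⟨l, hl, hlfree, hlne, hleval⟩ := ih c' (fun i hi => hcard i (hins i hi))
      (fun i hi φ hφ => by
        by_cases hib : i = b
        · subst hib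
          rw [hb'] at hφ
          rcases List.mem_cons.1 hφ with rfl | hφ
          · exact ⟨hχ, fun x hx => ((hχfree x).1 hx).2⟩
          · exact hc i (hins i hi) φ hφ
        · rw [hne' i hib] at hφ
          exact hc i (hins i hi) φ hφ)
      (fun i hi hir => by
        obtain ⟨φ, hφ⟩ := List.exists_mem_of_ne_nil _ (hne i (hins i hi) hir)
        exact List.ne_nil_of_mem (hmono i φ hφ))
      (fun i hi hir x hx => by
        obtain ⟨φ, hφ, hxφ⟩ := hV i (hins i hi) hir x hx
        exact ⟨φ, hmono i φ hφ, hxφ⟩)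
    refine ⟨l, hl, ?_, ?_, ?_⟩
    · rintro x hx ⟨i, hi, φ, hφ, hxφ⟩
      refine hlfree x hx ?_
      rcases Finset.mem_insert.1 hi with rfl | hi
      · have hxa := (hc i haA φ hφ).2 hxφ
        exact ⟨b, hb, χ, by simp [hb'], (hχfree x).2 ⟨hxa, hab r hr x hxa hx⟩⟩
      · exact ⟨i, hi, φ, hmono i φ hφ, hxφ⟩
    · exact fun _ => hlne ⟨b, hb, by simp [hb']⟩
    · intro L hLnd hL db S hS ν
      classical
      let L' := L.filter fun x => ∃ i ∈ A, x ∈ V i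
      have hL' : ∀ x, x ∈ L' ↔ x ∉ V r ∧ ∃ i ∈ A, x ∈ V i := fun x => by
        simp only [L', List.mem_filter, hL, decide_eq_true_eq]
        constructor
        · rintro ⟨⟨h1, -⟩, h2⟩
          exact ⟨h1, h2⟩
        · rintro ⟨h1, i, hi, hx⟩
          exact ⟨⟨h1, i, hins i hi, hx⟩, i, hi, hx⟩
      have hPA : ∀ x ∈ P, ∀ i ∈ A, x ∉ V i := fun x hx i hi hxi =>
        ((hP x).1 hx).2 (hab i hi x ((hP x).1 hx).1 hxi)
      have hperm : L.Perm (L' ++ P) := by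
        have hnd : (L' ++ P).Nodup := by
          refine List.nodup_append'.2 ⟨hLnd.filter _, Finset.nodup_toList _, fun x hx hxP => ?_⟩
          obtain ⟨-, i, hi, hxi⟩ := (hL' x).1 hx
          exact hPA x hxP i hi hxi
        refine (List.perm_ext_iff_of_nodup hLnd hnd).2 fun x => ?_
        rw [List.mem_append, hL, hL', hP]
        constructor
        · rintro ⟨h1, i, hi, hx⟩
          rcases Finset.mem_insert.1 hi with rfl | hi
          · by_cases hxb : x ∈ V b
            · exact Or.inl ⟨h1, b, hb, hxb⟩
            · exact Or.inr ⟨hx, hxb⟩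
          · exact Or.inl ⟨h1, i, hi, hx⟩
        · rintro (⟨h1, i, hi, hx⟩ | hx)
          · exact ⟨h1, i, hins i hi, hx⟩
          · exact ⟨hPA x ((hP x).2 hx) r hr, a, haA, hx.1⟩
      rw [hleval L' (hLnd.filter _) hL' db S hS, sumOut_perm hperm, sumOut_append]
      refine sumOut_congr (fun μ => ?_) ν
      have hsplit : ∀ μ, ∏ i ∈ insert a A, ((c i).map fun φ => φ.eval db μ).prod =
          (∏ i ∈ A, ((c i).map fun φ => φ.eval db μ).prod) * ψ.eval db μ := fun μ => by
        rw [Finset.prod_insert ha, mul_comm, hψeval]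
      rw [sumOut_congr hsplit, sumOut_mul_left (F := ψ.eval db), ← Formula.eval_exList hS
        (Finset.nodup_toList _) (fun y hy => hψV ▸ ((hP y).1 hy).1),
        ← Finset.mul_prod_erase A _ hb, ← Finset.mul_prod_erase A _ hb, hb']
      · have : ∀ i ∈ A.erase b, ((c' i).map fun φ => φ.eval db μ).prod =
            ((c i).map fun φ => φ.eval db μ).prod := fun i hi => by
          rw [hne' i (Finset.ne_of_mem_erase hi)]
        rw [Finset.prod_congr rfl this, List.map_cons, List.prod_cons]
        change χ.eval db μ * _ * _ = _ * _ * χ.eval db μ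
        ring
      · intro y hy μ d
        refine Finset.prod_congr rfl fun i hi => ?_
        congr 1
        refine List.map_congr_left fun φ hφ => ?_
        exact φ.eval_update_of_notMem db
          (fun hyφ => hPA y hy i hi ((hc i (hins i hi) φ hφ).2 hyφ)) μ d

theorem prod_prod_map_filter {α ι M : Type*} [CommMonoid M] [DecidableEq ι] (A : Finset ι)
    (g : α → ι) (f : α → M) (l : List α) (hl : ∀ a ∈ l, g a ∈ A) :
    ∏ i ∈ A, ((l.filter fun a => g a = i).map f).prod = (l.map f).prod := by
  induction l with
  | nil => simp
  | cons a l ih =>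
    have hstep : ∀ i, (((a :: l).filter fun a => g a = i).map f).prod =
        (if g a = i then f a else 1) * ((l.filter fun a => g a = i).map f).prod := fun i => by
      by_cases h : g a = i <;> simp [h]
    simp only [hstep, Finset.prod_mul_distrib]
    rw [Finset.prod_ite_eq, if_pos (hl a (by simp)),
      ih fun b hb => hl b (List.mem_cons_of_mem a hb)]
    simp

end Elimination

/-! ### From free-connex conjunctive queries to two variables -/

section Atoms

variable {σ : Vocabulary.{u, v}} {k : ℕ}

theorem Atom.vars_lift (a : Atom σ) : (a.lift k).vars = a.vars := by
  cases a <;> rfl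

theorem Atom.IsBinary.card_vars_le {a : Atom σ} (h : a.IsBinary) : a.vars.card ≤ 2 := by
  cases a with
  | rel R x =>
    have h1 := Finset.card_image_le (s := Finset.univ) (f := x)
    rw [Finset.card_univ, Fintype.card_fin] at h1
    exact h1.trans h
  | le x c => simp [vars]

theorem Query.vars_headAtom (Q : Query σ k) : Q.headAtom.vars = Q.body.free := by
  ext x
  rw [Q.mem_free_iff]
  change x ∈ Finset.univ.image Q.head ↔ _
  rw [Finset.mem_image]
  exact ⟨fun ⟨i, _, hi⟩ => ⟨i, hi⟩, fun ⟨i, hi⟩ => ⟨i, Finset.mem_univ i, hi⟩⟩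

theorem Query.card_free_le (Q : Query σ k) : Q.body.free.card ≤ k := by
  rw [← Q.vars_headAtom]
  exact Finset.card_image_le.trans (Finset.card_fin k).le

end Atoms

section ConjunctiveToTwoVariables

variable {σ : Vocabulary.{u, v}} {K : Type w} [CommSemiring K] {k : ℕ}

/-- In a join tree of the body and the head, rooted at the head, all variables that are not free in
the body can be summed out. -/
theorem Query.exists_narrow (Q : Query σ k) (hbin : Q.IsBinary) (hfc : Q.IsFreeConnex) :
    ∃ ψ : Formula σ, ψ.IsNarrow ∧ ψ.free = Q.body.free ∧
      ∀ (db : Database K σ) ν, Q.body.eval db ν = ψ.eval db ν := by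
  classical
  obtain ⟨hcq, -, htree⟩ := hfc
  obtain ⟨M, L, hM, hL, hatoms, hmem, hfree, heval⟩ :=
    Formula.IsPrenex.exists_exList (K := K) hcq
  obtain ⟨l, hl, hleval⟩ := hM.exists_list (K := K)
  have := ((Q.body.finite_atoms.image (Atom.lift k)).insert Q.headAtom).fintype
  let A : Set (Atom (σ.extend k)) := insert Q.headAtom (Atom.lift k '' Q.body.atoms)
  let r : A := ⟨Q.headAtom, Set.mem_insert _ _⟩
  have hRI := htree.runningIntersection r
  have hlA : ∀ a ∈ l, a.lift k ∈ A := fun a ha =>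
    Set.mem_insert_of_mem _ ⟨a, hatoms ▸ (hl a).1 ha, rfl⟩
  let c : A → List (Formula σ) := fun i => (l.filter fun a => a.lift k = i.1).map Formula.atom
  have hc : ∀ i φ, φ ∈ c i ↔ ∃ a ∈ l, a.lift k = i.1 ∧ Formula.atom a = φ := fun i φ => by
    simp [c, and_assoc]
  have hbody : ∀ i : A, i ≠ r → ∃ a ∈ l, a.lift k = i.1 := by
    rintro ⟨i, rfl | ⟨a, ha, rfl⟩⟩ hi
    · exact absurd rfl hi
    · exact ⟨a, (hl a).2 (hatoms ▸ ha), rfl⟩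
  have hlbin : ∀ a ∈ l, a.IsBinary := fun a ha => hbin.2 a (hatoms ▸ (hl a).1 ha)
  obtain ⟨Ψ, hΨ, hΨfree, hΨne, hΨeval⟩ := hRI.exists_narrow (K := K) c
    (fun i _ hi => by
      obtain ⟨a, ha, hai⟩ := hbody i hi
      rw [← hai, a.vars_lift]
      exact (hlbin a ha).card_vars_le)
    (fun i _ φ hφ => by
      obtain ⟨a, ha, hai, rfl⟩ := (hc i φ).1 hφ
      refine ⟨hlbin a ha, ?_⟩
      rw [← hai, a.vars_lift]
      exact subset_rfl)
    (fun i _ hi => by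
      obtain ⟨a, ha, hai⟩ := hbody i hi
      exact List.ne_nil_of_mem ((hc i _).2 ⟨a, ha, hai, rfl⟩))
    (fun i _ hi x hx => by
      obtain ⟨a, ha, hai⟩ := hbody i hi
      rw [← hai, a.vars_lift] at hx
      exact ⟨_, (hc i _).2 ⟨a, ha, hai, rfl⟩, hx⟩)
  have hocc : ∀ a ∈ l, ∃ i : A, Formula.atom a ∈ c i := fun a ha =>
    ⟨⟨a.lift k, hlA a ha⟩, (hc _ _).2 ⟨a, ha, rfl, rfl⟩⟩
  have hroot : r.1.vars = Q.body.free := Q.vars_headAtom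
  obtain ⟨a₀, ha₀⟩ := Q.body.atoms_nonempty
  have ha₀l : a₀ ∈ l := (hl a₀).2 (hatoms ▸ ha₀)
  obtain ⟨ψ, hψ, hψfree, hψeval⟩ := Formula.exists_conj (K := K)
    (hΨne ((hocc a₀ ha₀l).imp fun i hi => ⟨Finset.mem_univ i, List.ne_nil_of_mem hi⟩))
    fun φ hφ => (hΨ φ hφ).1
  refine ⟨ψ, hψ, ?_, fun db ν => ?_⟩
  · ext x
    rw [hψfree]
    constructor
    · rintro ⟨φ, hφ, hx⟩
      exact hroot ▸ (hΨ φ hφ).2 hx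
    · intro hx
      obtain ⟨a, ha, hxa⟩ := (hM.mem_free_iff x).1 (hfree x hx)
      obtain ⟨i, hi⟩ := hocc a ((hl a).2 ha)
      exact hΨfree x (hroot ▸ hx) ⟨i, Finset.mem_univ i, _, hi, hxa⟩
  · obtain ⟨S, hS⟩ := db.exists_isBounding
    rw [hψeval, heval db S hS, hΨeval L hL _ db S hS]
    · refine sumOut_congr (fun μ => ?_) ν
      rw [hleval, ← prod_prod_map_filter A.toFinset (Atom.lift k) (Atom.eval db μ) l
        fun a ha => Set.mem_toFinset.2 (hlA a ha), ← Finset.prod_set_coe]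
      refine Finset.prod_congr rfl fun i _ => ?_
      rw [List.map_map]
      rfl
    · intro x
      rw [hmem, hroot, hM.mem_free_iff, and_comm]
      refine and_congr_right fun hx => ⟨fun ⟨a, ha, hxa⟩ => ?_, fun ⟨i, _, hxi⟩ => ?_⟩
      · exact ⟨⟨a.lift k, hlA a ((hl a).2 ha)⟩, Finset.mem_univ _, a.vars_lift ▸ hxa⟩
      · have hir : i ≠ r := fun e => hx (hroot ▸ e ▸ hxi)
        obtain ⟨a, ha, hai⟩ := hbody i hir
        exact ⟨a, (hl a).1 ha, by rwa [← hai, a.vars_lift] at hxi⟩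

theorem Query.exists_isFOTwo (Q : Query σ k) (hbin : Q.IsBinary) (hfc : Q.IsFreeConnex) :
    ∃ Q' : Query σ k, Q'.IsFOTwo ∧ Q'.head = Q.head ∧ Q.Equivalent K Q' := by
  obtain ⟨ψ, hψ, hψfree, hψeval⟩ := Q.exists_narrow (K := K) hbin hfc
  obtain ⟨t, ht, htcard⟩ := Infinite.exists_superset_card_eq Q.body.free 2
    (Q.card_free_le.trans hbin.1)
  obtain ⟨p, q, hpq, rfl⟩ := Finset.card_eq_two.1 htcard
  obtain ⟨χ, hvars, hfree, hχbin, hχeval⟩ := hψ.exists_vars_subset_pair (K := K) hpq id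
    (Set.injOn_id _) fun x hx => ht (hψfree ▸ hx)
  rw [Finset.image_id, hψfree] at hfree
  refine ⟨⟨Q.head, χ, fun x => by rw [hfree, Q.mem_free_iff]⟩, ⟨⟨hbin.1, hχbin⟩, ?_⟩, rfl,
    Query.equivalent_of_eval_body_eq rfl fun db ν => ?_⟩
  · exact (Finset.card_le_card hvars).trans Finset.card_le_two
  · rw [hψeval]
    exact (hχeval db ν).symm

end ConjunctiveToTwoVariables

/-! ### From two variables to free-connex conjunctive queries -/

section TwoVariablesToConjunctive

variable {σ : Vocabulary.{u, v}} {K : Type w} [CommSemiring K] {k : ℕ}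

/-- Prenex form of a narrow formula. Bound variables get increasing fresh names, from `N` on and
from the outside to the inside. The smaller neighbours of a fresh variable `z` are then among the
other free variables of the formula that `z` quantifies, of which there is at most one. -/
theorem Formula.IsNarrow.exists_prenex {φ : Formula σ} (h : φ.IsNarrow) (ρ : Var → Var) (N : ℕ)
    (hρ : Set.InjOn ρ φ.free) (hN : ∀ x ∈ φ.free, ρ x < N) :
    ∃ (M : Formula σ) (L : List Var) (N' : ℕ), N ≤ N' ∧ M.IsConjunctionOfAtoms ∧
      (∀ a ∈ M.atoms, a.IsBinary) ∧ L.Nodup ∧ (∀ z : ℕ, z ∈ L → N ≤ z ∧ z < N') ∧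
      (∀ x, x ∈ M.free ↔ x ∈ φ.free.image ρ ∨ x ∈ L) ∧
      (∀ z : ℕ, N ≤ z → ∀ a ∈ M.atoms, ∀ b ∈ M.atoms, z ∈ a.vars → z ∈ b.vars →
        ∀ x ∈ a.vars, ∀ y ∈ b.vars, x < z → y < z → x = y) ∧
      ∀ (db : Database K σ) (S : Finset ℕ+), db.IsBounding S → ∀ ν,
        φ.eval db (ν ∘ ρ) = sumOut S L (M.eval db) ν := by
  have himage : ∀ (φ : Formula σ) (ρ : Var → Var) (N : ℕ), (∀ x ∈ φ.free, ρ x < N) →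
      ∀ z : ℕ, z ∈ φ.free.image ρ → z < N := fun φ ρ N hN z hz => by
    obtain ⟨x, hx, rfl⟩ := Finset.mem_image.1 hz
    exact hN x hx
  induction φ generalizing ρ N with
  | atom a =>
    refine ⟨atom (a.rename ρ), [], N, le_rfl, trivial, ?_, .nil, by simp, ?_, ?_,
      fun db S _ ν => (a.eval_rename db ρ ν).symm⟩
    · rintro _ rfl
      exact Atom.IsBinary.rename h ρ
    · intro x
      rw [free, free, a.vars_rename]
      simp
    · rintro z hz _ rfl b - hza
      rw [a.vars_rename] at hza
      exact absurd (himage (atom a) ρ N hN z hza) (by omega)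
  | ex y φ ih =>
    by_cases hy : y ∈ φ.free
    · have hw : N ∉ (φ.free.erase y).image ρ := fun hmem =>
        lt_irrefl N (himage (ex y φ) ρ N hN N hmem)
      obtain ⟨M, L, N', hN', hM, hbin, hL, hLN, hMfree, hlow, heval⟩ :=
        ih h.2 (Function.update ρ y N) (N + 1) (injOn_update_of_notMem_image hρ hw)
          fun x hx => by
            by_cases hxy : x = y
            · simp [hxy]
            · rw [Function.update_of_ne hxy]
              exact (hN x (Finset.mem_erase.2 ⟨hxy, hx⟩)).trans (Nat.lt_succ_self N)
      have hNimage : N ∈ φ.free.image (Function.update ρ y N) :=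
        Finset.mem_image.2 ⟨y, hy, Function.update_self _ _ _⟩
      have herase := image_update_erase hw
      refine ⟨M, N :: L, N', by omega, hM, hbin, List.nodup_cons.2 ⟨fun hmem => ?_, hL⟩,
        fun z hz => ?_, fun x => ?_, fun z hz => ?_, fun db S hS ν => ?_⟩
      · have := (hLN N hmem).1
        omega
      · rcases List.mem_cons.1 hz with rfl | hz
        · omega
        · have := hLN z hz
          omega
      · rw [hMfree, free, ← herase, Finset.mem_erase, List.mem_cons]
        by_cases hx : x = N
        · simp [hx, hNimage]
        · simp [hx]
      · rcases hz.eq_or_lt with rfl | hz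
        · have hcard : ((φ.free.erase y).image ρ).card ≤ 1 := by
            have h1 := Finset.card_image_le (s := φ.free.erase y) (f := ρ)
            have h2 := Finset.card_erase_add_one hy
            have h3 := h.1
            omega
          have hsmall : ∀ a ∈ M.atoms, ∀ x : ℕ, x ∈ a.vars → x < N →
              x ∈ (φ.free.erase y).image ρ := by
            intro a ha x hx hxN
            rw [← herase, Finset.mem_erase]
            refine ⟨hxN.ne, ((hMfree x).1 ((hM.mem_free_iff x).2 ⟨a, ha, hx⟩)).resolve_right ?_⟩
            intro hxL
            have := (hLN x hxL).1
            omega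
          intro a ha b hb _ _ x hx x' hx' hlt hlt'
          exact Finset.card_le_one.1 hcard x (hsmall a ha x hx hlt) x' (hsmall b hb x' hx' hlt')
        · exact hlow z hz
      · rw [eval_ex_of_mem hS hy]
        refine Finset.sum_congr rfl fun d _ => ?_
        rw [← heval db S hS, eval_update_comp_update db hw]
    · have e : φ.free.erase y = φ.free := Finset.erase_eq_of_notMem hy
      simp only [free, e] at hρ hN ⊢
      obtain ⟨M, L, N', h1, h2, h3, h4, h5, h6, h7, h8⟩ := ih h.2 ρ N hρ hN
      exact ⟨M, L, N', h1, h2, h3, h4, h5, h6, h7,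
        fun db S hS ν => by rw [eval_ex_of_notMem db hy, h8 db S hS]⟩
  | and φ φ' ih1 ih2 =>
    simp only [free, Finset.coe_union, Finset.mem_union] at hρ hN
    obtain ⟨M1, L1, N1, hN1, hM1, hbin1, hL1, hLN1, hfree1, hlow1, heval1⟩ :=
      ih1 h.1 ρ N (hρ.mono Set.subset_union_left) fun x hx => hN x (Or.inl hx)
    obtain ⟨M2, L2, N2, hN2, hM2, hbin2, hL2, hLN2, hfree2, hlow2, heval2⟩ :=
      ih2 h.2 ρ N1 (hρ.mono Set.subset_union_right)
        fun x hx => (hN x (Or.inr hx)).trans_le hN1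
    have hfr1 : ∀ z : ℕ, z ∈ M1.free → z < N1 := fun z hz => by
      rcases (hfree1 z).1 hz with hz | hz
      · exact (himage φ ρ N (fun x hx => hN x (Or.inl hx)) z hz).trans_le hN1
      · exact (hLN1 z hz).2
    have hfr2 : ∀ z : ℕ, z ∈ M2.free → z < N ∨ N1 ≤ z := fun z hz => by
      rcases (hfree2 z).1 hz with hz | hz
      · exact Or.inl (himage φ' ρ N (fun x hx => hN x (Or.inr hx)) z hz)
      · exact Or.inr (hLN2 z hz).1
    refine ⟨and M1 M2, L1 ++ L2, N2, hN1.trans hN2, ⟨hM1, hM2⟩,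
      fun a ha => ha.elim (hbin1 a) (hbin2 a),
      List.nodup_append'.2 ⟨hL1, hL2, fun z hz1 hz2 => ?_⟩, fun z hz => ?_, fun x => ?_,
      fun z hz a ha b hb hza hzb => ?_, fun db S hS ν => ?_⟩
    · have h1 := (hLN1 z hz1).2
      have h2 := (hLN2 z hz2).1
      omega
    · rcases List.mem_append.1 hz with hz | hz
      · have := hLN1 z hz
        omega
      · have := hLN2 z hz
        omega
    · simp only [free, Finset.mem_union, hfree1, hfree2, Finset.image_union, List.mem_append]
      tauto
    · by_cases hzN : z < N1
      · have hnot : ∀ a ∈ M2.atoms, z ∉ a.vars := fun a ha hza => by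
          have := hfr2 z ((hM2.mem_free_iff z).2 ⟨a, ha, hza⟩)
          omega
        exact hlow1 z hz a (ha.resolve_right fun ha => hnot a ha hza)
          b (hb.resolve_right fun hb => hnot b hb hzb) hza hzb
      · have hnot : ∀ a ∈ M1.atoms, z ∉ a.vars := fun a ha hza =>
          hzN (hfr1 z ((hM1.mem_free_iff z).2 ⟨a, ha, hza⟩))
        exact hlow2 z (not_lt.1 hzN) a (ha.resolve_left fun ha => hnot a ha hza)
          b (hb.resolve_left fun hb => hnot b hb hzb) hza hzb
    · rw [sumOut_append, eval, heval1 db S hS, heval2 db S hS]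
      have hinner : ∀ μ, sumOut S L2 ((and M1 M2).eval db) μ =
          sumOut S L2 (M2.eval db) μ * M1.eval db μ := fun μ => by
        rw [mul_comm]
        refine sumOut_mul_left (fun y hy μ d => ?_) μ
        refine M1.eval_update_of_notMem db (fun hyM => ?_) μ d
        have h1 := hfr1 y hyM
        have h2 := (hLN2 y hy).1
        omega
      rw [sumOut_congr hinner, sumOut_mul_left, mul_comm]
      intro y hy μ d
      rw [← heval2 db S hS, ← heval2 db S hS]
      refine φ'.eval_congr db _ _ fun x hx => Function.update_of_ne (fun e => ?_) _ _
      exact absurd (e ▸ hN x (Or.inr hx)) (not_lt.2 (hLN1 y hy).1)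

/-- A variable below `N` has at most one smaller neighbour as soon as at most two variables are
below `N`. -/
theorem hasUniqueLowerNeighbors_of_card_le_two {ι : Type*} {V : ι → Finset Var} {A : Set ι}
    {F : Finset Var} {N : ℕ} (hF : F.card ≤ 2) (hV : ∀ a ∈ A, ∀ x ∈ V a, x < N → x ∈ F)
    (h : ∀ z, N ≤ z → ∀ a ∈ A, ∀ b ∈ A, z ∈ V a → z ∈ V b →
      ∀ x ∈ V a, ∀ y ∈ V b, x < z → y < z → x = y) :
    HasUniqueLowerNeighbors V A := by
  intro z a ha b hb hza hzb x hx y hy hxz hyz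
  by_cases hz : N ≤ z
  · exact h z hz a ha b hb hza hzb x hx y hy hxz hyz
  · push Not at hz
    have hcard := Finset.card_erase_add_one (hV a ha z hza hz)
    refine Finset.card_le_one.1 (show (F.erase z).card ≤ 1 by omega) x ?_ y ?_
    · exact Finset.mem_erase.2 ⟨hxz.ne, hV a ha x hx (hxz.trans hz)⟩
    · exact Finset.mem_erase.2 ⟨hyz.ne, hV b hb y hy (hyz.trans hz)⟩

theorem Query.exists_isFreeConnex (Q : Query σ k) (hQ : Q.IsFOTwo) :
    ∃ Q' : Query σ k, Q'.IsBinary ∧ Q'.IsFreeConnex ∧ Q'.head = Q.head ∧ Q.Equivalent K Q' := by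
  have hN : ∀ x ∈ Q.body.free, id x < Q.body.free.sup id + 1 := fun x hx =>
    Nat.lt_succ_of_le (Finset.le_sup (f := id) hx)
  generalize Q.body.free.sup id + 1 = N at hN
  obtain ⟨M, L, N', -, hM, hbin, hL, hLN, hMfree, hlow, heval⟩ :=
    (Formula.isNarrow_of_card_vars_le hQ.2 hQ.1.2).exists_prenex (K := K) id N
      (Set.injOn_id _) hN
  rw [Finset.image_id] at hMfree
  have hLM : ∀ y ∈ L, y ∈ M.free := fun y hy => (hMfree y).2 (Or.inr hy)
  have hfree : (Formula.exList L M).free = Q.body.free := by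
    ext x
    rw [Formula.mem_free_exList, hMfree]
    refine ⟨fun hx => hx.1.resolve_right hx.2, fun hx => ⟨Or.inl hx, fun hxL => ?_⟩⟩
    exact absurd (hN x hx) (not_lt.2 (hLN x hxL).1)
  let Q' : Query σ k := ⟨Q.head, Formula.exList L M, fun x => by rw [hfree, Q.mem_free_iff]⟩
  have hatoms : Q'.body.atoms = M.atoms := Formula.atoms_exList L M
  have hhead : Q'.headAtom.vars = Q.body.free := Q.vars_headAtom
  have hcard : Q.body.free.card ≤ 2 := Q.card_free_le.trans hQ.1.1
  have hsmall : ∀ a ∈ M.atoms, ∀ x ∈ a.vars, x < N → x ∈ Q.body.free := fun a ha x hx hxN =>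
    ((hMfree x).1 ((hM.mem_free_iff x).2 ⟨a, ha, hx⟩)).resolve_right fun hxL =>
      absurd hxN (not_lt.2 (hLN x hxL).1)
  refine ⟨Q', ⟨hQ.1.1, fun a ha => hbin a (hatoms ▸ ha)⟩,
    ⟨Formula.isPrenex_exList L hM, ?_, ?_⟩, rfl,
    Query.equivalent_of_eval_body_eq rfl fun db ν => ?_⟩
  · refine hasJoinTree_of_hasUniqueLowerNeighbors Q'.body.finite_atoms Q'.body.atoms_nonempty ?_
    rw [hatoms]
    exact hasUniqueLowerNeighbors_of_card_le_two hcard hsmall hlow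
  · refine hasJoinTree_of_hasUniqueLowerNeighbors
      ((Q'.body.finite_atoms.image (Atom.lift k)).insert _) (Set.insert_nonempty _ _) ?_
    rw [hatoms]
    refine hasUniqueLowerNeighbors_of_card_le_two (N := N) hcard ?_ ?_
    · rintro _ (rfl | ⟨a, ha, rfl⟩) x hx hxN
      · exact hhead ▸ hx
      · exact hsmall a ha x (a.vars_lift ▸ hx) hxN
    · have hnot : ∀ z, N ≤ z → z ∉ Q'.headAtom.vars := fun z hz hmem =>
        absurd (hN z (hhead ▸ hmem)) (not_lt.2 hz)
      rintro z hz _ (rfl | ⟨a, ha, rfl⟩) _ (rfl | ⟨b, hb, rfl⟩) hza hzb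
      · exact absurd hza (hnot z hz)
      · exact absurd hza (hnot z hz)
      · exact absurd hzb (hnot z hz)
      · rw [a.vars_lift] at hza ⊢
        rw [b.vars_lift] at hzb ⊢
        exact hlow z hz a ha b hb hza hzb
  · obtain ⟨S, hS⟩ := db.exists_isBounding
    rw [Formula.eval_exList hS hL hLM, ← heval db S hS, Function.comp_id]

end TwoVariablesToConjunctive

end SemiringQuery

theorem mainTheorem4 {K : Type w} [CommSemiring K] [Nontrivial K]
    (σ : SemiringQuery.Vocabulary.{u, v}) (k : ℕ) :
    (∀ Q : SemiringQuery.Query σ k, Q.IsBinary → Q.IsFreeConnex →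
      ∃ Q' : SemiringQuery.Query σ k,
        Q'.IsFOTwo ∧ Q'.head = Q.head ∧ Q.Equivalent K Q') ∧
    (∀ Q : SemiringQuery.Query σ k, Q.IsFOTwo →
      ∃ Q' : SemiringQuery.Query σ k,
        Q'.IsBinary ∧ Q'.IsFreeConnex ∧ Q'.head = Q.head ∧ Q.Equivalent K Q') :=
  ⟨fun Q hbin hfc => Q.exists_isFOTwo hbin hfc, fun Q hQ => Q.exists_isFreeConnex hQ⟩
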